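/- Let $\{0,1\}^*$ be the set of finite bit strings. A prefix-free decompressor for $\mathbb{N}$ (respectively, for $\{0,1\}^*$) is a partial computable map $D$ from $\{0,1\}^*$ to $\mathbb{N}$ (respectively, to $\{0,1\}^*$) whose domain contains no string together with a proper extension of it. Put $K_D(x)=\min\{|p| : D(p)=x\}$, with $\min\emptyset=\infty$. Such a $D$ is optimal if for every prefix-free decompressor $D'$ with the same target there is a constant $c$ with $K_D(x)\le K_{D'}(x)+c$ for all $x$. The prefix complexity $K$ is $K_U$ on $\mathbb{N}$ and $K_V$ on $\{0,1\}^*$, where $U$ and $V$ are any optimal prefix-free decompressors for $\mathbb{N}$ and for $\{0,1\}^*$; it is well defined up to an additive constant. An infinite binary sequence $a=a_0a_1a_2\ldots$ is called $K$-trivial if $K(a_0a_1\ldots a_{n-1})=K(n)+O(1)$, that is, if there is a constant $c$ with $|K(a_0a_1\ldots a_{n-1})-K(n)|\le c$ for all $n\ge 0$. **Theorem (Chaitin).** Every $K$-trivial sequence is $\mathbf{0}'$-computable, that is, the function $i\mapsto a_i$ is computable with an oracle for the halting problem. -/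

import Mathlib

namespace KTriv

/-- A prefix-free decompressor: a partial computable function on bit strings ("programs") whose
domain contains no string together with a proper extension of it. -/
structure IsPrefixDecompressor {α : Type*} [Primcodable α] (D : List Bool →. α) : Prop where
  partrec : Partrec D
  prefixFree : ∀ p q : List Bool, (D p).Dom → (D q).Dom → p <+: q → p = q

/-- Complexity of `x` with respect to the decompressor `D`: the least length of a program that
`D` maps to `x`, and `⊤` if there is no such program. -/
noncomputable def complexity {α : Type*} (D : List Bool →. α) (x : α) : ℕ∞ :=
  ⨅ (p : List Bool) (_ : x ∈ D p), (p.length : ℕ∞)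

/-- An optimal prefix-free decompressor: one whose complexity function is minimal, up to an
additive constant, among all prefix-free decompressors. The prefix complexity `K` is
`complexity U` for an optimal `U`; it is determined up to an additive constant. -/
structure IsOptimal {α : Type*} [Primcodable α] (U : List Bool →. α) : Prop extends
    IsPrefixDecompressor U where
  optimal : ∀ D : List Bool →. α, IsPrefixDecompressor D →
    ∃ c : ℕ, ∀ x : α, complexity U x ≤ complexity D x + c

/-- The prefix `a₀ a₁ … a₍ₙ₋₁₎` of an infinite bit sequence. -/
def initialSegment (a : ℕ → Bool) (n : ℕ) : List Bool :=
  (List.range n).map a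

/-- `K(a₀ … a₍ₙ₋₁₎) = K(n) + O(1)`, where `K` on natural numbers is the complexity with respect to
`U`, and `K` on bit strings is the complexity with respect to `V`. -/
def IsKTrivial (U : List Bool →. ℕ) (V : List Bool →. List Bool) (a : ℕ → Bool) : Prop :=
  ∃ c : ℕ, ∀ n : ℕ,
    complexity V (initialSegment a n) ≤ complexity U n + c ∧
      complexity U n ≤ complexity V (initialSegment a n) + c

open Classical in
/-- The oracle `0'` for the halting problem: on the pair `⟨e, x⟩` it answers `1` if the program
with number `e` halts on the input `x`, and `0` otherwise. -/
noncomputable def haltingOracle : ℕ →. ℕ := fun m =>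
  Part.some (if ((Denumerable.ofNat Nat.Partrec.Code m.unpair.1).eval m.unpair.2).Dom
    then 1 else 0)

end KTriv

/-! The core is a counting bound (`exists_card_bound`): for fixed `c`, the number of strings `s` of
length `n` with `K(s) ≤ K(n) + c` is bounded independently of `n`. Many short programs producing
strings of length `n` would, taken together, give a description of `n` shorter than `K(n)`. Such
descriptions come from the Kraft–Chaitin theorem (`exists_decompressor_of_requests`): an enumerable
family of requested program lengths of total weight at most 1/2 is met by a prefix-free
decompressor.

Hence only finitely many sequences satisfy `K(b₀…bₙ₋₁) ≤ K(n) + c` for all `n`, and `a` is singled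
out among them by a finite prefix `t`. By compactness, finitely many of these inequalities together
with `t` already determine any given bit of `a`. Since `K` is approximable only from above, this
yields a `Σ₂` definition of the bit: some finite list of programs bounding values `K(j)` admits no
finite string through `t` with the opposite bit. A total function with a `Σ₂` graph is computable in
`0'`. -/

namespace KTriv

open scoped ENNReal

/-! ### Closure properties of enumerable predicates. -/

section RE

variable {α β σ : Type*} [Primcodable α] [Primcodable β] [Primcodable σ]

theorem exists_code_of_rePred {p : α → Prop} (hp : REPred p) :
    ∃ c : Nat.Partrec.Code, ∀ n, (c.eval n).Dom ↔ ∃ a, Encodable.decode n = some a ∧ p a := by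
  obtain ⟨c, hc⟩ := Nat.Partrec.Code.exists_code.1 hp
  refine ⟨c, fun n => ?_⟩
  rw [hc, Part.dom_iff_mem]
  cases h : (Encodable.decode n : Option α) <;> simp [h]

/-- Halting within `s` steps is primitive recursive. The closure properties below manipulate such
stage relations. -/
theorem exists_primrecRel_of_rePred {p : α → Prop} (hp : REPred p) :
    ∃ R : α → ℕ → Prop, PrimrecRel R ∧ ∀ a, p a ↔ ∃ s, R a s := by
  obtain ⟨c, hc⟩ := exists_code_of_rePred hp
  refine ⟨fun a s => (c.evaln s (Encodable.encode a)).isSome = true, ?_, fun a => ?_⟩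
  · refine Primrec.eq.comp (Primrec.option_isSome.comp (Nat.Partrec.Code.primrec_evaln.comp
      ((Primrec.snd.pair (Primrec.const c)).pair (Primrec.encode.comp Primrec.fst))))
      (Primrec.const true)
  · have := hc (Encodable.encode a)
    simp only [Encodable.encodek, Option.some.injEq, exists_eq_left'] at this
    rw [← this, Part.dom_iff_mem]
    simp only [Nat.Partrec.Code.evaln_complete, Option.isSome_iff_exists]
    exact exists_comm

theorem rePred_of_primrecRel {R : α → ℕ → Prop} (hR : PrimrecRel R) :
    REPred fun a => ∃ s, R a s := by
  classical
  have h : Partrec fun a => Nat.rfind fun s => Part.some (decide (R a s)) :=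
    Partrec.rfind hR.decide.to_comp.partrec
  refine h.dom_re.of_eq fun a => ?_
  refine Nat.rfind_dom'.trans ?_
  simp

theorem rePred_exists {p : α → β → Prop} (hp : REPred fun x : α × β => p x.1 x.2) :
    REPred fun a => ∃ b, p a b := by
  obtain ⟨R, hR, h⟩ := exists_primrecRel_of_rePred hp
  have hR' : PrimrecRel fun (b : β) (x : α × ℕ) => R (x.1, b) x.2 :=
    hR.comp (Primrec.pair (Primrec.fst.comp Primrec.snd) Primrec.fst)
      (Primrec.snd.comp Primrec.snd)
  -- One number codes both the witness and its stage; an invalid code gives the empty list and so no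
  -- witness.
  have : PrimrecRel fun (a : α) (s : ℕ) =>
      ∃ b ∈ (Encodable.decode s.unpair.1 : Option β).toList, R (a, b) s.unpair.2 :=
    hR'.exists_mem_list.comp
      (Primrec.optionToList.comp (Primrec.decode.comp
        (Primrec.fst.comp (Primrec.unpair.comp Primrec.snd))))
      (Primrec.pair Primrec.fst (Primrec.snd.comp (Primrec.unpair.comp Primrec.snd)))
  refine (rePred_of_primrecRel this).of_eq fun a => ?_
  constructor
  · rintro ⟨s, b, -, hb⟩
    exact ⟨b, (h (a, b)).2 ⟨_, hb⟩⟩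
  · rintro ⟨b, hb⟩
    obtain ⟨s, hs⟩ := (h (a, b)).1 hb
    exact ⟨Nat.pair (Encodable.encode b) s, b, by simp, by simpa using hs⟩

theorem rePred_comp {p : β → Prop} (hp : REPred p) {f : α → β} (hf : Computable f) :
    REPred fun a => p (f a) :=
  Partrec.comp hp hf

theorem rePred_and {p q : α → Prop} (hp : REPred p) (hq : REPred q) :
    REPred fun a => p a ∧ q a := by
  have : Partrec fun a => (Part.assert (p a) fun _ => Part.some ()).bind
      fun _ => (Part.assert (q a) fun _ => Part.some ()) :=
    Partrec.bind hp (Partrec.comp hq Computable.fst).to₂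
  refine this.dom_re.of_eq fun a => ?_
  rw [Part.dom_iff_mem]
  simp

theorem rePred_of_primrecPred {p : α → Prop} (hp : PrimrecPred p) : REPred p :=
  hp.computablePred.to_re

/-- Finitely many stages have a common bound, so one unbounded search for that bound suffices. -/
theorem rePred_forall_mem_list {p : α → β → Prop} (hp : REPred fun x : α × β => p x.1 x.2) :
    REPred fun x : List α × β => ∀ a ∈ x.1, p a x.2 := by
  obtain ⟨R, hR, h⟩ := exists_primrecRel_of_rePred hp
  have h1 : PrimrecRel fun (s : ℕ) (x : α × β) => R x s := hR.swap
  have h2 : PrimrecRel fun (a : α) (x : β × ℕ) => ∃ s ∈ List.range x.2, R (a, x.1) s :=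
    h1.exists_mem_list.comp (Primrec.list_range.comp (Primrec.snd.comp Primrec.snd))
      (Primrec.pair Primrec.fst (Primrec.fst.comp Primrec.snd))
  have h3 : PrimrecRel fun (x : List α × β) (N : ℕ) =>
      ∀ a ∈ x.1, ∃ s ∈ List.range N, R (a, x.2) s :=
    h2.forall_mem_list.comp (Primrec.fst.comp Primrec.fst)
      (Primrec.pair (Primrec.snd.comp Primrec.fst) Primrec.snd)
  refine (rePred_of_primrecRel h3).of_eq fun x => ?_
  constructor
  · rintro ⟨N, hN⟩ a ha
    obtain ⟨s, -, hs⟩ := hN a ha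
    exact (h (a, x.2)).2 ⟨s, hs⟩
  · intro H
    have H' : ∀ a : α, ∃ s, a ∈ x.1 → R (a, x.2) s := fun a => by
      by_cases ha : a ∈ x.1
      · obtain ⟨s, hs⟩ := (h (a, x.2)).1 (H a ha)
        exact ⟨s, fun _ => hs⟩
      · exact ⟨0, fun h => absurd h ha⟩
    choose f hf using H'
    refine ⟨(x.1.map f).sum + 1, fun a ha => ⟨f a, ?_, hf a ha⟩⟩
    rw [List.mem_range, Nat.lt_succ_iff]
    exact List.single_le_sum (by simp) _ (List.mem_map_of_mem ha)

theorem rePred_mem {f : α →. σ} (hf : Partrec f) : REPred fun x : α × σ => x.2 ∈ f x.1 := by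
  have h : REPred fun x : (α × σ) × σ => x.2 = x.1.2 :=
    rePred_of_primrecPred (Primrec.eq.comp Primrec.snd (Primrec.snd.comp Primrec.fst))
  have : Partrec fun x : α × σ => (f x.1).bind
      fun y => (Part.assert (y = x.2) fun _ => Part.some ()) :=
    Partrec.bind (hf.comp Computable.fst) (Partrec.to₂ h)
  refine this.dom_re.of_eq fun a => ?_
  rw [Part.dom_iff_mem]
  simp

end RE

/-! ### Computability in the halting problem. -/

section Oracle

variable {α β : Type*} [Primcodable α] [Primcodable β]

open Classical in
theorem recursiveIn_haltingOracle_of_rePred {p : α → Prop} (hp : REPred p) :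
    Nat.RecursiveIn {haltingOracle} fun n =>
      Part.some (if ∃ a, Encodable.decode n = some a ∧ p a then 1 else 0) := by
  obtain ⟨c, hc⟩ := exists_code_of_rePred hp
  have h1 : Nat.RecursiveIn {haltingOracle} fun n => Part.some (Nat.pair (Encodable.encode c) n) :=
    Nat.Primrec.recursiveIn (Primrec.nat_iff.1
      (Primrec₂.natPair.comp (Primrec.const _) Primrec.id))
  have h2 := Nat.RecursiveIn.oracle haltingOracle (Set.mem_singleton haltingOracle)
  refine (h2.comp h1).of_eq fun n => ?_
  refine (Part.bind_some _ _).trans ?_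
  simp [haltingOracle, hc]

/-- A total function with `Σ₂` graph is computable in the halting problem. -/
theorem computableIn_haltingOracle_of_graph {a : ℕ → Bool} {P Q : ℕ × Bool × β → Prop}
    (hP : REPred P) (hQ : REPred Q)
    (h : ∀ n i, a n = i ↔ ∃ b, P (n, i, b) ∧ ¬ Q (n, i, b)) :
    ComputableIn {haltingOracle} a := by
  classical
  -- Zeros of `f` are exactly the codes where `P` holds and `Q` fails; an invalid code gives the
  -- value 1.
  let f : ℕ → ℕ := fun x => (1 - if ∃ a, Encodable.decode x = some a ∧ P a then 1 else 0) +
    if ∃ a, Encodable.decode x = some a ∧ Q a then 1 else 0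
  have hf : Nat.RecursiveIn {haltingOracle} fun x => Part.some (f x) := by
    have hg : Nat.RecursiveIn {haltingOracle}
        fun n => Part.some ((1 - n.unpair.1) + n.unpair.2) :=
      Nat.Primrec.recursiveIn (Primrec.nat_iff.1 (Primrec.nat_add.comp
        (Primrec.nat_sub.comp (Primrec.const 1) (Primrec.fst.comp Primrec.unpair))
        (Primrec.snd.comp Primrec.unpair)))
    refine (hg.comp (Nat.RecursiveIn.pair (recursiveIn_haltingOracle_of_rePred hP)
      (recursiveIn_haltingOracle_of_rePred hQ))).of_eq fun x => ?_
    simp [f, Seq.seq]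
  have hf0 : ∀ n z, f (Nat.pair n z) = 0 ↔
      ∃ i b, Encodable.decode z = some (i, b) ∧ P (n, i, b) ∧ ¬ Q (n, i, b) := by
    intro n z
    have hd : (Encodable.decode (Nat.pair n z) : Option (ℕ × Bool × β)) =
        (Encodable.decode z : Option (Bool × β)).map (Prod.mk n) := by
      rw [Encodable.decode_prod_val]
      simp
    simp only [f, hd]
    rcases (Encodable.decode z : Option (Bool × β)) with _ | ⟨i, b⟩
    · simp
    · by_cases h1 : P (n, i, b) <;> by_cases h2 : Q (n, i, b) <;> simp [h1, h2]
  have hout : Nat.RecursiveIn {haltingOracle} fun z => Part.some (Encodable.encode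
      (((Encodable.decode z : Option (Bool × β)).map Prod.fst).getD false)) :=
    Nat.Primrec.recursiveIn (Primrec.nat_iff.1 (Primrec.encode.comp (Primrec.option_getD.comp
      (Primrec.option_map Primrec.decode (Primrec.fst.comp Primrec.snd).to₂)
      (Primrec.const false))))
  refine (hout.comp (Nat.RecursiveIn.rfind hf)).of_eq fun n => ?_
  obtain ⟨b, hb⟩ := (h n (a n)).1 rfl
  obtain ⟨z, hz, -⟩ := Nat.rfind_min' (p := fun z => decide (f (Nat.pair n z) = 0))
    (m := Encodable.encode (a n, b))
    (decide_eq_true ((hf0 n _).2 ⟨_, _, Encodable.encodek (a n, b), hb⟩))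
  have hz0 : f (Nat.pair n z) = 0 := by simpa using Nat.rfind_spec hz
  obtain ⟨i, b', hd, hi⟩ := (hf0 n z).1 hz0
  -- The search may stop at a witness other than `b`, but any witness carries the right bit.
  have : a n = i := (h n i).2 ⟨b', hi⟩
  subst this
  have hz' : Nat.rfind (fun z => Part.some (decide (f (Nat.pair n z) = 0))) = Part.some z :=
    Part.eq_some_iff.2 hz
  simp [hz', hd, -Encodable.decode_prod_val]

end Oracle

/-! ### The Kraft inequality. -/

section Kraft

/-- No element of the set is a proper prefix of another one. -/
def PrefixFree (S : Set (List Bool)) : Prop :=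
  ∀ p ∈ S, ∀ q ∈ S, p <+: q → p = q

theorem PrefixFree.uniquelyDecodable {S : Set (List Bool)} (hS : PrefixFree S) (h0 : [] ∉ S) :
    InformationTheory.UniquelyDecodable S := by
  intro L₁
  induction L₁ with
  | nil =>
    intro L₂ _ h2 h
    cases L₂ with
    | nil => rfl
    | cons q L =>
      have : q = [] := by simpa using (List.append_eq_nil_iff.1 h.symm).1
      exact absurd (h2 q (by simp)) (this ▸ h0)
  | cons p L ih =>
    intro L₂ h1 h2 h
    cases L₂ with
    | nil =>
      have : p = [] := by simpa using (List.append_eq_nil_iff.1 h).1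
      exact absurd (h1 p (by simp)) (this ▸ h0)
    | cons q L' =>
      have hpq : p = q := by
        rcases List.prefix_or_prefix_of_prefix (List.prefix_append p L.flatten)
          (show q <+: p ++ L.flatten from ⟨L'.flatten, by simpa using h.symm⟩) with hp | hp
        · exact hS p (h1 p (by simp)) q (h2 q (by simp)) hp
        · exact (hS q (h2 q (by simp)) p (h1 p (by simp)) hp).symm
      subst hpq
      rw [ih L' (fun w hw => h1 w (by simp [hw])) (fun w hw => h2 w (by simp [hw]))
        (by simpa using h)]

open Classical in
-- The empty string can only be the sole element. Without it the set is uniquely decodable, and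
-- Kraft–McMillan applies to its finite subsets.
theorem PrefixFree.kraft {S : Set (List Bool)} (hS : PrefixFree S) :
    ∑' p : List Bool, (if p ∈ S then (2⁻¹ : ℝ≥0∞) ^ p.length else 0) ≤ 1 := by
  by_cases h0 : [] ∈ S
  · rw [tsum_eq_single []]
    · simp [h0]
    · intro p hp
      rw [if_neg fun h => hp (hS [] h0 p h List.nil_prefix).symm]
  · rw [ENNReal.tsum_eq_iSup_sum]
    refine iSup_le fun F => ?_
    rw [← Finset.sum_filter]
    have hu : InformationTheory.UniquelyDecodable (↑(F.filter (· ∈ S)) : Set (List Bool)) :=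
      fun L₁ L₂ h1 h2 => hS.uniquelyDecodable h0 L₁ L₂
        (fun w hw => (Finset.mem_filter.1 (h1 w hw)).2)
        (fun w hw => (Finset.mem_filter.1 (h2 w hw)).2)
    have hk := InformationTheory.kraft_mcmillan_inequality hu
    have he : ∀ n : ℕ, (2⁻¹ : ℝ≥0∞) ^ n = ENNReal.ofReal ((1 / Fintype.card Bool : ℝ) ^ n) := by
      intro n
      rw [ENNReal.ofReal_pow (by positivity)]
      congr 1
      rw [Fintype.card_bool, one_div, ENNReal.ofReal_inv_of_pos (by norm_num)]
      simp
    simp only [he]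
    rw [← ENNReal.ofReal_sum_of_nonneg fun _ _ => by positivity]
    exact ENNReal.ofReal_le_one.2 hk

theorem IsPrefixDecompressor.prefixFree_dom {α : Type*} [Primcodable α] {D : List Bool →. α}
    (hD : IsPrefixDecompressor D) : PrefixFree {p | (D p).Dom} :=
  fun p hp q hq h => hD.prefixFree p q hp hq h

end Kraft

/-! ### Binary values of strings. -/

section BinVal

/-- The number with the given binary digits, most significant digit first. -/
def binVal (p : List Bool) : ℕ :=
  p.foldl (fun v b => 2 * v + b.toNat) 0

theorem binVal_concat (p : List Bool) (b : Bool) : binVal (p ++ [b]) = 2 * binVal p + b.toNat := by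
  simp [binVal]

theorem binVal_append (p r : List Bool) :
    binVal (p ++ r) = binVal p * 2 ^ r.length + binVal r := by
  induction r using List.reverseRecOn with
  | nil => simp [binVal]
  | append_singleton r b ih =>
    rw [← List.append_assoc, binVal_concat, ih, binVal_concat]
    simp [pow_succ]
    ring

theorem binVal_lt (p : List Bool) : binVal p < 2 ^ p.length := by
  induction p using List.reverseRecOn with
  | nil => simp [binVal]
  | append_singleton r b ih =>
    rw [binVal_concat, List.length_append, List.length_singleton, pow_succ]
    have := Bool.toNat_lt b
    omega

theorem exists_binVal_eq (k x : ℕ) (hx : x < 2 ^ k) : ∃ p, p.length = k ∧ binVal p = x := by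
  induction k generalizing x with
  | zero => exact ⟨[], rfl, by simp at hx; simp [binVal, hx]⟩
  | succ k ih =>
    obtain ⟨p, hp, hv⟩ := ih (x / 2) (by rw [pow_succ] at hx; omega)
    refine ⟨p ++ [decide (x % 2 = 1)], by simp [hp], ?_⟩
    rw [binVal_concat, hv]
    rcases Nat.mod_two_eq_zero_or_one x with h | h <;> simp [h] <;> omega

theorem primrec_binVal : Primrec binVal := by
  have h : Primrec₂ fun (_ : List Bool) (x : ℕ × Bool) => 2 * x.1 + x.2.toNat :=
    (Primrec.nat_add.comp (Primrec.nat_double.comp (Primrec.fst.comp Primrec.snd))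
      ((Primrec.dom_bool Bool.toNat).comp (Primrec.snd.comp Primrec.snd))).to₂
  exact Primrec.list_foldl Primrec.id (Primrec.const 0) h

theorem primrec₂_pow : Primrec₂ fun a b : ℕ => a ^ b :=
  Primrec₂.unpaired'.1 Nat.Primrec.pow

end BinVal

/-! ### The Kraft–Chaitin theorem. -/

section KraftChaitin

variable {α : Type*}

/-- The total length `num / den` reserved for the requests before the time `t`, where a request
of a program of length `k` reserves an interval of length `2 / 2 ^ k`. -/
def reserved (req : ℕ → Option (α × ℕ)) : ℕ → ℕ × ℕ
  | 0 => (0, 1)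
  | t + 1 => (req t).elim (reserved req t) fun x =>
      ((reserved req t).1 * 2 ^ x.2 + 2 * (reserved req t).2, (reserved req t).2 * 2 ^ x.2)

/-- The output allocated to the program `p` at the time `t`. -/
def allocate (req : ℕ → Option (α × ℕ)) (p : List Bool) (t : ℕ) : Option α :=
  (req t).bind fun x =>
    if p.length = x.2 ∧ (reserved req t).1 * 2 ^ x.2 < binVal p * (reserved req t).2 ∧
      binVal p * (reserved req t).2 ≤ (reserved req t).1 * 2 ^ x.2 + (reserved req t).2
    then some x.1 else none

variable {req : ℕ → Option (α × ℕ)}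

theorem allocate_eq_some {p : List Bool} {t : ℕ} {a : α} :
    allocate req p t = some a ↔ req t = some (a, p.length) ∧
      (reserved req t).1 * 2 ^ p.length < binVal p * (reserved req t).2 ∧
      binVal p * (reserved req t).2 ≤ (reserved req t).1 * 2 ^ p.length + (reserved req t).2 := by
  unfold allocate
  rcases h : req t with _ | ⟨b, k⟩
  · simp
  · simp only [Option.bind_some, Option.ite_none_right_eq_some, Option.some.injEq, Prod.mk.injEq]
    constructor
    · rintro ⟨⟨rfl, h1⟩, rfl⟩
      exact ⟨⟨rfl, rfl⟩, h1⟩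
    · rintro ⟨⟨rfl, rfl⟩, h1⟩
      exact ⟨⟨rfl, h1⟩, rfl⟩

theorem reserved_snd_pos (req : ℕ → Option (α × ℕ)) (t : ℕ) : 0 < (reserved req t).2 := by
  induction t with
  | zero => simp [reserved]
  | succ t ih =>
    rw [reserved]
    cases req t <;> simp [ih]

/-- The endpoint of the part of the unit interval reserved before the time `t`. -/
noncomputable def reservedPoint (req : ℕ → Option (α × ℕ)) (t : ℕ) : ℝ :=
  (reserved req t).1 / (reserved req t).2

theorem reservedPoint_succ (t : ℕ) : reservedPoint req (t + 1) =
    reservedPoint req t + 2 * (req t).elim 0 fun x => (2⁻¹ : ℝ) ^ x.2 := by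
  have := reserved_snd_pos req t
  unfold reservedPoint
  rw [reserved]
  cases req t
  · simp
  · simp only [Option.elim_some]
    push_cast
    rw [inv_pow]
    field_simp

theorem reservedPoint_eq_sum (t : ℕ) : reservedPoint req t =
    2 * ∑ s ∈ Finset.range t, (req s).elim 0 fun x => (2⁻¹ : ℝ) ^ x.2 := by
  induction t with
  | zero => simp [reservedPoint, reserved]
  | succ t ih => rw [reservedPoint_succ, ih, Finset.sum_range_succ, mul_add]

theorem reservedPoint_mono : Monotone (reservedPoint req) := by
  refine monotone_nat_of_le_succ fun t => ?_
  rw [reservedPoint_succ]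
  cases req t <;> simp

theorem allocate_bounds {p : List Bool} {t : ℕ} {a : α} (h : allocate req p t = some a) :
    reservedPoint req t < binVal p / 2 ^ p.length ∧
      (binVal p + 1) / 2 ^ p.length ≤ reservedPoint req (t + 1) := by
  obtain ⟨h1, h2, h3⟩ := allocate_eq_some.1 h
  have h0 : (0 : ℝ) < (reserved req t).2 := by exact_mod_cast reserved_snd_pos req t
  have h2' : ((reserved req t).1 : ℝ) * 2 ^ p.length < binVal p * (reserved req t).2 := by
    exact_mod_cast h2
  have h3' : (binVal p : ℝ) * (reserved req t).2 ≤
      (reserved req t).1 * 2 ^ p.length + (reserved req t).2 := by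
    exact_mod_cast h3
  rw [reservedPoint_succ, h1]
  simp only [Option.elim_some]
  unfold reservedPoint
  constructor
  · rw [div_lt_div_iff₀ h0 (by positivity)]
    exact h2'
  · rw [inv_pow, div_le_iff₀ (by positivity), add_mul, mul_assoc, inv_mul_cancel₀ (by positivity),
      div_mul_eq_mul_div]
    have : (binVal p : ℝ) ≤ (reserved req t).1 * 2 ^ p.length / (reserved req t).2 + 1 := by
      rw [div_add_one h0.ne', le_div_iff₀ h0]
      exact h3'
    linarith

/-- The dyadic interval of an extension lies inside that of the prefix, while intervals reserved at
different times do not overlap. -/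
theorem allocate_time_unique {p q : List Bool} {s t : ℕ} {a b : α} (hpq : p <+: q)
    (hp : allocate req p s = some a) (hq : allocate req q t = some b) : s = t := by
  obtain ⟨r, rfl⟩ := hpq
  obtain ⟨hp1, hp2⟩ := allocate_bounds hp
  obtain ⟨hq1, hq2⟩ := allocate_bounds hq
  have hr : (binVal r : ℝ) + 1 ≤ 2 ^ r.length := by exact_mod_cast binVal_lt r
  have e : ((binVal (p ++ r) : ℕ) : ℝ) = binVal p * 2 ^ r.length + binVal r := by
    rw [binVal_append]
    push_cast
    ring
  have hl : (2 : ℝ) ^ (p ++ r).length = 2 ^ p.length * 2 ^ r.length := by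
    rw [List.length_append, pow_add]
  rw [e, hl] at hq1 hq2
  have hle : (binVal p : ℝ) / 2 ^ p.length ≤
      (binVal p * 2 ^ r.length + binVal r + 1) / (2 ^ p.length * 2 ^ r.length) := by
    rw [div_le_div_iff₀ (by positivity) (by positivity)]
    have : (0 : ℝ) ≤ (binVal r + 1) * 2 ^ p.length := by positivity
    nlinarith
  have hle' : (binVal p * 2 ^ r.length + binVal r : ℝ) / (2 ^ p.length * 2 ^ r.length) ≤
      (binVal p + 1) / 2 ^ p.length := by
    rw [div_le_div_iff₀ (by positivity) (by positivity)]
    have : (binVal r : ℝ) * 2 ^ p.length ≤ 2 ^ r.length * 2 ^ p.length := by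
      gcongr
      linarith
    nlinarith
  rcases lt_trichotomy s t with h | h | h
  · have := reservedPoint_mono (req := req) (Nat.succ_le_of_lt h)
    simp only [Nat.succ_eq_add_one] at this
    linarith
  · exact h
  · have := reservedPoint_mono (req := req) (Nat.succ_le_of_lt h)
    simp only [Nat.succ_eq_add_one] at this
    linarith

/-- An interval of length `2 / 2 ^ k` contains a whole dyadic interval of length `1 / 2 ^ k`,
starting at the first grid point strictly beyond the left end. This doubling lets requests be served
in any order. -/
theorem exists_allocate {t k : ℕ} {a : α} (h : req t = some (a, k))
    (hS : reservedPoint req (t + 1) ≤ 1) : ∃ p, p.length = k ∧ allocate req p t = some a := by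
  have h0 := reserved_snd_pos req t
  set u := (reserved req t).1 with hu
  set d := (reserved req t).2 with hd
  have h1 : u * 2 ^ k < (u * 2 ^ k / d + 1) * d := by
    have := Nat.lt_mul_div_succ (u * 2 ^ k) h0
    linarith [mul_comm d (u * 2 ^ k / d + 1)]
  have h2 : (u * 2 ^ k / d + 1) * d ≤ u * 2 ^ k + d := by
    have := Nat.div_mul_le_self (u * 2 ^ k) d
    linarith [add_mul (u * 2 ^ k / d) 1 d]
  have hlt : u * 2 ^ k / d + 1 < 2 ^ k := by
    rw [reservedPoint, reserved, h] at hS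
    simp only [Option.elim_some, ← hu, ← hd] at hS
    rw [div_le_one (by positivity)] at hS
    have hS' : u * 2 ^ k + 2 * d ≤ d * 2 ^ k := by exact_mod_cast hS
    have : (u * 2 ^ k / d + 1) * d < 2 ^ k * d := by linarith [mul_comm d (2 ^ k)]
    exact lt_of_mul_lt_mul_right this h0.le
  obtain ⟨p, hp, hv⟩ := exists_binVal_eq k _ hlt
  refine ⟨p, hp, allocate_eq_some.2 ⟨by rw [hp]; exact h, ?_, ?_⟩⟩
  · rw [hp, hv]; exact h1
  · rw [hp, hv]; exact h2

variable [Primcodable α]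

theorem computable_reserved (hreq : Computable req) : Computable (reserved req) := by
  have hpow : Computable fun x : (ℕ × ℕ × ℕ × ℕ) × α × ℕ => 2 ^ x.2.2 :=
    primrec₂_pow.to_comp.comp (Computable.const 2)
      (Computable.snd.comp Computable.snd)
  have hst : Computable fun x : (ℕ × ℕ × ℕ × ℕ) × α × ℕ => x.1.2.2 :=
    Computable.snd.comp (Computable.snd.comp Computable.fst)
  have hstep : Computable₂ fun (_ : ℕ) (x : ℕ × ℕ × ℕ) =>
      ((req x.1).casesOn x.2 fun y => (x.2.1 * 2 ^ y.2 + 2 * x.2.2, x.2.2 * 2 ^ y.2) : ℕ × ℕ) :=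
    Computable.option_casesOn
      (hreq.comp (Computable.fst.comp Computable.snd)) (Computable.snd.comp Computable.snd)
      (Computable.pair
        (Primrec.nat_add.to_comp.comp
          (Primrec.nat_mul.to_comp.comp (Computable.fst.comp hst) hpow)
          (Primrec.nat_double.to_comp.comp (Computable.snd.comp hst)))
        (Primrec.nat_mul.to_comp.comp (Computable.snd.comp hst) hpow)).to₂
  refine (Computable.nat_rec Computable.id (Computable.const (0, 1)) hstep).of_eq fun t => ?_
  induction t with
  | zero => rfl
  | succ t ih =>
    rw [reserved, ← ih]
    simp only [id]
    cases req t <;> rfl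

theorem computable_allocate (hreq : Computable req) : Computable₂ (allocate req) := by
  have hcond : PrimrecPred fun x : (ℕ × ℕ × ℕ) × ℕ × ℕ =>
      x.1.1 = x.1.2.1 ∧ x.2.1 * 2 ^ x.1.2.1 < x.1.2.2 * x.2.2 ∧
        x.1.2.2 * x.2.2 ≤ x.2.1 * 2 ^ x.1.2.1 + x.2.2 := by
    have h1 : Primrec fun x : (ℕ × ℕ × ℕ) × ℕ × ℕ => x.1.2.1 :=
      Primrec.fst.comp (Primrec.snd.comp Primrec.fst)
    have hd : Primrec fun x : (ℕ × ℕ × ℕ) × ℕ × ℕ => x.2.2 := Primrec.snd.comp Primrec.snd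
    have hl : Primrec fun x : (ℕ × ℕ × ℕ) × ℕ × ℕ => x.2.1 * 2 ^ x.1.2.1 :=
      Primrec.nat_mul.comp (Primrec.fst.comp Primrec.snd)
        (primrec₂_pow.comp (Primrec.const 2) h1)
    have hr : Primrec fun x : (ℕ × ℕ × ℕ) × ℕ × ℕ => x.1.2.2 * x.2.2 :=
      Primrec.nat_mul.comp (Primrec.snd.comp (Primrec.snd.comp Primrec.fst)) hd
    exact (Primrec.eq.comp (Primrec.fst.comp Primrec.fst) h1).and
      ((Primrec.nat_lt.comp hl hr).and (Primrec.nat_le.comp hr (Primrec.nat_add.comp hl hd)))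
  have hp : Computable fun x : (List Bool × ℕ) × α × ℕ => x.1.1 :=
    Computable.fst.comp Computable.fst
  have hdata := Computable.pair
    ((Computable.list_length.comp hp).pair
      ((Computable.snd.comp Computable.snd).pair (primrec_binVal.to_comp.comp hp)))
    ((computable_reserved hreq).comp (Computable.snd.comp Computable.fst))
  refine (Computable.option_bind (hreq.comp Computable.snd) (Computable.to₂ (Computable.cond
    (hcond.decide.to_comp.comp hdata)
    (Computable.option_some.comp (Computable.fst.comp Computable.snd))
    (Computable.const none)))).of_eq fun x => ?_
  simp only [allocate, Bool.cond_decide]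

theorem exists_decompressor_of_requests (hreq : Computable req)
    (hsum : ∑' t, ((req t).elim 0 fun x => (2⁻¹ : ℝ≥0∞) ^ x.2) ≤ 2⁻¹) :
    ∃ D : List Bool →. α, IsPrefixDecompressor D ∧
      ∀ t a k, req t = some (a, k) → complexity D a ≤ k := by
  refine ⟨fun p => Nat.rfindOpt (allocate req p),
    ⟨Partrec.rfindOpt (computable_allocate hreq), fun p q hp hq hpq => ?_⟩, fun t a k h => ?_⟩
  · obtain ⟨s, a, hs⟩ := Nat.rfindOpt_dom.1 hp
    obtain ⟨t, b, ht⟩ := Nat.rfindOpt_dom.1 hq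
    obtain rfl := allocate_time_unique hpq hs ht
    have h1 := (allocate_eq_some.1 hs).1
    -- Equal times mean the same request, hence equal lengths.
    rw [(allocate_eq_some.1 ht).1] at h1
    simp only [Option.some.injEq, Prod.mk.injEq] at h1
    exact hpq.eq_of_length h1.2.symm
  · have hS : reservedPoint req (t + 1) ≤ 1 := by
      rw [reservedPoint_eq_sum]
      have h2 := (ENNReal.sum_le_tsum (Finset.range (t + 1))).trans hsum
      have h3 := ENNReal.toReal_mono (by simp) h2
      rw [ENNReal.toReal_sum] at h3
      · have h4 : ∀ s, ((req s).elim 0 fun x => (2⁻¹ : ℝ≥0∞) ^ x.2).toReal =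
            (req s).elim 0 fun x => (2⁻¹ : ℝ) ^ x.2 := by
          intro s
          cases req s <;> simp
        simp only [h4, ENNReal.toReal_inv, ENNReal.toReal_ofNat] at h3
        linarith
      · intro s _
        cases req s <;> simp
    obtain ⟨p, hp, hal⟩ := exists_allocate h hS
    have hmem : a ∈ Nat.rfindOpt (allocate req p) := by
      obtain ⟨b, hb⟩ := Part.dom_iff_mem.1 (Nat.rfindOpt_dom.2 ⟨t, a, hal⟩)
      obtain ⟨s, hs⟩ := Nat.rfindOpt_spec hb
      obtain rfl := allocate_time_unique List.prefix_rfl hs hal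
      obtain rfl : b = a := Option.some.inj (hs.symm.trans hal)
      exact hb
    exact (iInf₂_le p hmem).trans (by rw [hp])

end KraftChaitin

/-! ### Requests indexed by an enumerable set. -/

section Requests

variable {α β : Type*} [Primcodable α] [Primcodable β]

open Classical in
theorem exists_decompressor_of_rePred {W : α → Prop} (hW : REPred W) {out : α → β} {k : α → ℕ}
    (hout : Computable out) (hk : Computable k)
    (hsum : ∑' a, (if W a then (2⁻¹ : ℝ≥0∞) ^ k a else 0) ≤ 2⁻¹) :
    ∃ D : List Bool →. β, IsPrefixDecompressor D ∧
      ∀ a, W a → complexity D (out a) ≤ k a := by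
  obtain ⟨R, hR, hWR⟩ := exists_primrecRel_of_rePred hW
  -- The time codes an index and a stage. Issuing a request only at its least successful stage
  -- charges its weight once.
  let first : ℕ × α → Prop := fun x =>
    Encodable.encode x.2 = x.1.unpair.1 ∧ R x.2 x.1.unpair.2 ∧
      ∀ s ∈ List.range x.1.unpair.2, ¬ R x.2 s
  have hfirst : PrimrecPred first := by
    have h1 : Primrec fun x : ℕ × α => x.1.unpair.1 :=
      Primrec.fst.comp (Primrec.unpair.comp Primrec.fst)
    have h2 : Primrec fun x : ℕ × α => x.1.unpair.2 :=
      Primrec.snd.comp (Primrec.unpair.comp Primrec.fst)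
    have h3 : PrimrecRel fun (s : ℕ) (a : α) => ¬ R a s := PrimrecPred.not hR.swap
    exact (Primrec.eq.comp (Primrec.encode.comp Primrec.snd) h1).and
      ((hR.comp Primrec.snd h2).and
        (h3.forall_mem_list.comp (Primrec.list_range.comp h2) Primrec.snd))
  let req : ℕ → Option (β × ℕ) := fun t =>
    (Encodable.decode t.unpair.1 : Option α).bind fun a =>
      bif decide (first (t, a)) then some (out a, k a) else none
  have hreq : Computable req :=
    Computable.option_bind
      (Computable.decode.comp (Computable.fst.comp Computable.unpair))
      (Computable.to₂ (Computable.cond hfirst.decide.to_comp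
        (Computable.option_some.comp
          ((hout.comp Computable.snd).pair (hk.comp Computable.snd)))
        (Computable.const none)))
  have hex : ∀ a, W a → ∃ t, first (t, a) := by
    intro a ha
    have h := (hWR a).1 ha
    refine ⟨Nat.pair (Encodable.encode a) (Nat.find h), by simp, by simpa using Nat.find_spec h,
      fun s hs => Nat.find_min h (by simpa using hs)⟩
  have huniq : ∀ a t t', first (t, a) → first (t', a) → t = t' := by
    rintro a t t' ⟨h1, h2, h3⟩ ⟨h1', h2', h3'⟩
    have h4 : t.unpair.2 = t'.unpair.2 := by
      rcases lt_trichotomy t.unpair.2 t'.unpair.2 with h | h | h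
      · exact absurd h2 (h3' _ (List.mem_range.2 h))
      · exact h
      · exact absurd h2' (h3 _ (List.mem_range.2 h))
    rw [← Nat.pair_unpair t, ← Nat.pair_unpair t', h4, ← h1, ← h1']
  have hreq_of : ∀ a t, first (t, a) → req t = some (out a, k a) := by
    intro a t h
    simp only [req, ← h.1, Encodable.encodek, Option.bind_some, h, decide_true, cond_true]
  have hle : ∀ t, ((req t).elim 0 fun x => (2⁻¹ : ℝ≥0∞) ^ x.2) ≤
      ∑' a, if first (t, a) then (if W a then (2⁻¹ : ℝ≥0∞) ^ k a else 0) else 0 := by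
    intro t
    rcases hd : (Encodable.decode t.unpair.1 : Option α) with _ | a
    · simp [req, hd]
    · by_cases h : first (t, a)
      · refine le_trans ?_ (ENNReal.le_tsum a)
        rw [hreq_of a t h, if_pos h, if_pos ((hWR a).2 ⟨_, h.2.1⟩)]
        rfl
      · simp [req, hd, h]
  obtain ⟨D, hD, h⟩ := exists_decompressor_of_requests hreq (by
    refine le_trans (ENNReal.tsum_le_tsum hle) (le_trans ?_ hsum)
    rw [ENNReal.tsum_comm]
    refine ENNReal.tsum_le_tsum fun a => ?_
    by_cases ha : W a
    · obtain ⟨t, ht⟩ := hex a ha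
      rw [tsum_eq_single t fun t' h => if_neg fun h' => h (huniq a _ _ h' ht), if_pos ht]
    · simp [ha])
  refine ⟨D, hD, fun a ha => ?_⟩
  obtain ⟨t, ht⟩ := hex a ha
  exact h t _ _ (hreq_of a t ht)

end Requests

/-! ### Finiteness of complexity on the natural numbers. -/

section Complexity

variable {α : Type*} {D : List Bool →. α}

theorem complexity_le_coe_iff {x : α} {k : ℕ} :
    complexity D x ≤ k ↔ ∃ p, x ∈ D p ∧ p.length ≤ k := by
  constructor
  · intro h
    by_contra! hc
    have : ((k + 1 : ℕ) : ℕ∞) ≤ complexity D x :=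
      le_iInf₂ fun p hp => by exact_mod_cast hc p hp
    have := this.trans h
    norm_cast at this
    omega
  · rintro ⟨p, hp, hl⟩
    exact (iInf₂_le p hp).trans (by exact_mod_cast hl)

theorem tsum_two_inv_pow_add (l : ℕ) : ∑' j : ℕ, (2⁻¹ : ℝ≥0∞) ^ (j + l) = 2 * 2⁻¹ ^ l := by
  simp_rw [pow_add]
  rw [ENNReal.tsum_mul_right, ENNReal.tsum_geometric, ENNReal.one_sub_inv_two, inv_inv]

theorem IsOptimal.exists_complexity_eq {U : List Bool →. ℕ} (hU : IsOptimal U) (n : ℕ) :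
    ∃ k : ℕ, complexity U n = k := by
  obtain ⟨D, hD, h⟩ := exists_decompressor_of_requests (req := fun t => some (t, t + 2))
    (Computable.option_some.comp (Computable.id.pair
      (Primrec.nat_add.comp Primrec.id (Primrec.const 2)).to_comp)) (by
    simp only [Option.elim_some, tsum_two_inv_pow_add]
    rw [pow_two, ← mul_assoc, ENNReal.mul_inv_cancel (by simp) (by simp), one_mul])
  obtain ⟨c, hc⟩ := hU.optimal D hD
  have : complexity U n ≤ ((n + 2 + c : ℕ) : ℕ∞) := (hc n).trans (by
    push_cast
    gcongr
    exact_mod_cast h n n (n + 2) rfl)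
  obtain ⟨k, hk, -⟩ := ENat.le_natCast_iff.1 this
  exact ⟨k, hk⟩

end Complexity

/-! ### The counting bound. -/

section Coding

variable {V : List Bool →. List Bool}

/-- There are at least `4 ^ m` programs of length at most `r + m` with output of length `n`. -/
def ManyPrograms (V : List Bool →. List Bool) (x : ℕ × ℕ × ℕ) : Prop :=
  ∃ L : List (List Bool), (∀ q ∈ L, ∃ s, s ∈ V q ∧ q.length ≤ x.2.1 + x.2.2 ∧ s.length = x.1) ∧
    L.Nodup ∧ 4 ^ x.2.2 ≤ L.length

theorem primrecPred_nodup {α : Type*} [Primcodable α] [DecidableEq α] :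
    PrimrecPred (List.Nodup : List α → Prop) := by
  have h1 : Primrec₂ fun (L : List α) (b : α) => (L.filter fun a => a = b).length :=
    Primrec.list_length.comp (PrimrecRel.listFilter Primrec.eq)
  have h2 : PrimrecRel fun (b : α) (L : List α) => (L.filter fun a => a = b).length ≤ 1 :=
    Primrec.nat_le.comp (h1.comp Primrec.snd Primrec.fst) (Primrec.const 1)
  refine (h2.forall_mem_list.comp Primrec.id Primrec.id).of_eq fun L => ?_
  rw [List.nodup_iff_count_le_one]
  simp only [id, List.count_eq_length_filter]
  constructor
  · intro h a
    by_cases ha : a ∈ L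
    · exact h a ha
    · rw [List.filter_eq_nil_iff.2 fun x hx => by
        simpa using ne_of_mem_of_not_mem hx ha]
      simp
  · exact fun h a _ => h a

theorem rePred_manyPrograms (hV : Partrec V) : REPred (ManyPrograms V) := by
  have h1 : REPred fun x : (List Bool × ℕ × ℕ × ℕ) × List Bool =>
      x.2 ∈ V x.1.1 ∧ x.1.1.length ≤ x.1.2.2.1 + x.1.2.2.2 ∧ x.2.length = x.1.2.1 := by
    have hx : Primrec fun x : (List Bool × ℕ × ℕ × ℕ) × List Bool => x.1.2 :=
      Primrec.snd.comp Primrec.fst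
    have hy : Primrec fun x : (List Bool × ℕ × ℕ × ℕ) × List Bool => x.1.2.2 :=
      Primrec.snd.comp hx
    refine rePred_and (rePred_comp (rePred_mem hV)
      ((Computable.fst.comp Computable.fst).pair Computable.snd)) (rePred_of_primrecPred ?_)
    exact (Primrec.nat_le.comp (Primrec.list_length.comp (Primrec.fst.comp Primrec.fst))
      (Primrec.nat_add.comp (Primrec.fst.comp hy) (Primrec.snd.comp hy))).and
      (Primrec.eq.comp (Primrec.list_length.comp Primrec.snd) (Primrec.fst.comp hx))
  have h2 : REPred fun x : List Bool × ℕ × ℕ × ℕ =>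
      ∃ s, s ∈ V x.1 ∧ x.1.length ≤ x.2.2.1 + x.2.2.2 ∧ s.length = x.2.1 :=
    rePred_exists h1
  have h3 : PrimrecPred fun x : (ℕ × ℕ × ℕ) × List (List Bool) =>
      x.2.Nodup ∧ 4 ^ x.1.2.2 ≤ x.2.length := by
    have h4 : Primrec fun x : (ℕ × ℕ × ℕ) × List (List Bool) => 4 ^ x.1.2.2 :=
      primrec₂_pow.comp (Primrec.const 4) (Primrec.snd.comp (Primrec.snd.comp Primrec.fst))
    exact (primrecPred_nodup.comp Primrec.snd).and
      (Primrec.nat_le.comp h4 (Primrec.list_length.comp Primrec.snd))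
  have h5 : REPred fun x : (ℕ × ℕ × ℕ) × List (List Bool) =>
      ∀ q ∈ x.2, ∃ s, s ∈ V q ∧ q.length ≤ x.1.2.1 + x.1.2.2 ∧ s.length = x.1.1 :=
    (rePred_comp (rePred_forall_mem_list (p := fun q x =>
        ∃ s, s ∈ V q ∧ q.length ≤ x.2.1 + x.2.2 ∧ s.length = x.1) h2)
      (Computable.snd.pair Computable.fst)).of_eq fun _ => Iff.rfl
  exact rePred_exists (rePred_and h5 (rePred_of_primrecPred h3))

open Classical in
theorem tsum_two_inv_pow_of_le (l m : ℕ) :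
    ∑' r : ℕ, (if l ≤ r + m then (2⁻¹ : ℝ≥0∞) ^ (r + m) else 0) ≤ 2 * 2⁻¹ ^ l := by
  calc ∑' r : ℕ, (if l ≤ r + m then (2⁻¹ : ℝ≥0∞) ^ (r + m) else 0)
      ≤ ∑' k : ℕ, (if l ≤ k then (2⁻¹ : ℝ≥0∞) ^ k else 0) :=
        ENNReal.tsum_comp_le_tsum_of_injective
          (f := fun r => r + m) (add_left_injective m)
          fun k => if l ≤ k then (2⁻¹ : ℝ≥0∞) ^ k else 0
    _ = 2 * 2⁻¹ ^ l := by
      rw [← Summable.sum_add_tsum_nat_add' (k := l) ENNReal.summable, ← tsum_two_inv_pow_add,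
        Finset.sum_eq_zero fun k hk => if_neg (by simpa using hk), zero_add]
      simp

open Classical in
-- Each program `q` of length at most `r + m` with output of length `n` is charged `2⁻³ · 2⁻ᵐ ·
-- 2⁻⁽ʳ⁺ᵐ⁾`, and `4 ^ m` such charges pay for one request of length `r + 3`. Summed over `n`, `r`
-- and `m`, the charge to `q` is at most `2⁻³ · 2 · 2 · 2^(-|q|)`, so Kraft leaves 1/2. Using `4 ^
-- m` instead of `2 ^ m` provides the factor `2⁻ᵐ` that makes the sum over `m` converge.
theorem tsum_manyPrograms_le (hV : IsPrefixDecompressor V) :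
    ∑' x : ℕ × ℕ × ℕ, (if ManyPrograms V x then (2⁻¹ : ℝ≥0∞) ^ (x.2.1 + 3) else 0) ≤ 2⁻¹ := by
  let A : List Bool → ℕ → ℝ≥0∞ := fun q n => if ∃ s, s ∈ V q ∧ s.length = n then 1 else 0
  let B : List Bool → ℕ → ℕ → ℝ≥0∞ := fun q r m =>
    if q.length ≤ r + m then (2⁻¹ : ℝ≥0∞) ^ (r + m) else 0
  have hterm : ∀ n r m, (if ManyPrograms V (n, r, m) then (2⁻¹ : ℝ≥0∞) ^ (r + 3) else 0) ≤
      ∑' q, 2⁻¹ ^ 3 * (2⁻¹ ^ m * (B q r m * A q n)) := by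
    intro n r m
    split_ifs with h
    · obtain ⟨L, hL, hnd, hlen⟩ := h
      refine le_trans ?_ (ENNReal.sum_le_tsum L.toFinset)
      rw [Finset.sum_congr rfl (g := fun _ => 2⁻¹ ^ 3 * (2⁻¹ ^ m * (2⁻¹ : ℝ≥0∞) ^ (r + m)))]
      · rw [Finset.sum_const, List.toFinset_card_of_nodup hnd, nsmul_eq_mul]
        have h4 : ((4 ^ m : ℕ) : ℝ≥0∞) ≤ L.length := by exact_mod_cast hlen
        refine le_trans (le_of_eq ?_) (mul_le_mul_left h4 _)
        have h1 : (4 : ℝ≥0∞) ^ m * (2⁻¹ ^ m * 2⁻¹ ^ m) = 1 := by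
          rw [← mul_pow, ← mul_pow]
          have : (4 : ℝ≥0∞) * (2⁻¹ * 2⁻¹) = 1 := by
            rw [show (4 : ℝ≥0∞) = 2 * 2 by norm_num, mul_mul_mul_comm,
              ENNReal.mul_inv_cancel (by simp) (by simp), one_mul]
          rw [this, one_pow]
        push_cast
        rw [pow_add, pow_add]
        calc (2⁻¹ : ℝ≥0∞) ^ r * 2⁻¹ ^ 3 = 2⁻¹ ^ r * 2⁻¹ ^ 3 * (4 ^ m * (2⁻¹ ^ m * 2⁻¹ ^ m)) := by
              rw [h1, mul_one]
          _ = _ := by ring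
      · intro q hq
        obtain ⟨s, hs, hl, hn⟩ := hL q (by simpa using hq)
        simp only [A, B]
        rw [if_pos hl, if_pos ⟨s, hs, hn⟩, mul_one]
    · exact zero_le
  -- A program has at most one output, hence counts for at most one `n`.
  have hA : ∀ q, ∑' n, A q n ≤ if (V q).Dom then 1 else 0 := by
    intro q
    split_ifs with h
    · rw [tsum_eq_single ((V q).get h).length]
      · simp only [A]
        split_ifs <;> simp
      · rintro n hn
        refine if_neg ?_
        rintro ⟨s, hs, rfl⟩
        exact hn (by rw [Part.get_eq_of_mem hs h])
    · rw [ENNReal.tsum_eq_zero.2]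
      intro n
      refine if_neg ?_
      rintro ⟨s, hs, -⟩
      exact h (Part.dom_iff_mem.2 ⟨s, hs⟩)
  calc ∑' x : ℕ × ℕ × ℕ, (if ManyPrograms V x then (2⁻¹ : ℝ≥0∞) ^ (x.2.1 + 3) else 0)
      ≤ ∑' x : ℕ × ℕ × ℕ, ∑' q, 2⁻¹ ^ 3 * (2⁻¹ ^ x.2.2 * (B q x.2.1 x.2.2 * A q x.1)) :=
        ENNReal.tsum_le_tsum fun x => hterm x.1 x.2.1 x.2.2
    _ = ∑' q, 2⁻¹ ^ 3 * ∑' m, 2⁻¹ ^ m * ∑' r, B q r m * ∑' n, A q n := by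
        rw [ENNReal.tsum_comm]
        refine tsum_congr fun q => ?_
        rw [ENNReal.tsum_mul_left, ENNReal.tsum_prod', ENNReal.tsum_comm, ENNReal.tsum_prod',
          ENNReal.tsum_comm]
        simp only [ENNReal.tsum_mul_left]
    _ ≤ ∑' q, 2⁻¹ ^ 3 * ∑' m, 2⁻¹ ^ m * ((2 * 2⁻¹ ^ q.length) * if (V q).Dom then 1 else 0) := by
        refine ENNReal.tsum_le_tsum fun q => ?_
        gcongr with m
        rw [ENNReal.tsum_mul_right]
        exact mul_le_mul' (tsum_two_inv_pow_of_le _ _) (hA q)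
    _ = ∑' q : List Bool, 2⁻¹ * (if q ∈ {p | (V p).Dom} then (2⁻¹ : ℝ≥0∞) ^ q.length else 0) := by
        refine tsum_congr fun q => ?_
        rw [ENNReal.tsum_mul_right, ENNReal.tsum_geometric, ENNReal.one_sub_inv_two, inv_inv]
        have : (2⁻¹ : ℝ≥0∞) ^ 3 * (2 * 2) = 2⁻¹ := by
          rw [pow_succ, pow_two, mul_assoc, mul_assoc, ← mul_assoc 2⁻¹ 2 2,
            ENNReal.inv_mul_cancel (by simp) (by simp), one_mul,
            ENNReal.inv_mul_cancel (by simp) (by simp), mul_one]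
        rw [← mul_assoc, ← mul_assoc, ← mul_assoc, mul_assoc _ 2 2, this]
        simp
    _ ≤ 2⁻¹ := by
        rw [ENNReal.tsum_mul_left]
        exact mul_le_of_le_one_right' hV.prefixFree_dom.kraft

/-- The decompressor built from the requests serves all `m` at once, so `m` may be chosen after its
optimality constant `d` is known. -/
theorem exists_card_bound {U : List Bool →. ℕ} (hU : IsOptimal U) (hV : IsPrefixDecompressor V)
    (c : ℕ) : ∃ B : ℕ, ∀ (n : ℕ) (F : Finset (List Bool)),
      (∀ s ∈ F, s.length = n ∧ complexity V s ≤ complexity U n + c) → F.card < B := by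
  classical
  obtain ⟨D, hD, hDle⟩ := exists_decompressor_of_rePred (rePred_manyPrograms hV.partrec)
    (out := Prod.fst) (k := fun x => x.2.1 + 3) Computable.fst
    (Primrec.nat_add.to_comp.comp (Computable.fst.comp Computable.snd) (Computable.const 3))
    (tsum_manyPrograms_le hV)
  obtain ⟨d, hd⟩ := hU.optimal D hD
  -- With `m = c + d + 4` and `r = K + c - m`, the request would give `K ≤ r + 3 + d = K - 1`.
  refine ⟨4 ^ (c + d + 4), fun n F hF => ?_⟩
  by_contra! hcard
  set m := c + d + 4 with hm
  obtain ⟨K, hK⟩ := hU.exists_complexity_eq n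
  have hprog : ∀ s : List Bool, ∃ q, s ∈ F → s ∈ V q ∧ q.length ≤ K + c := by
    intro s
    by_cases hs : s ∈ F
    · have h := (hF s hs).2
      rw [hK] at h
      obtain ⟨q, hq⟩ := complexity_le_coe_iff.1 (by exact_mod_cast h)
      exact ⟨q, fun _ => hq⟩
    · exact ⟨[], fun h => absurd h hs⟩
  choose f hf using hprog
  have hinj : Set.InjOn f F := fun s hs t ht h =>
    Part.mem_unique (hf s hs).1 (h ▸ (hf t ht).1)
  by_cases hmk : m ≤ K + c
  · have hmany : ManyPrograms V (n, K + c - m, m) := by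
      refine ⟨(F.image f).toList, fun q hq => ?_, Finset.nodup_toList _, ?_⟩
      · obtain ⟨s, hs, rfl⟩ := Finset.mem_image.1 (Finset.mem_toList.1 hq)
        refine ⟨s, (hf s hs).1, ?_, (hF s hs).1⟩
        have := (hf s hs).2
        simp only
        omega
      · rw [Finset.length_toList, Finset.card_image_of_injOn hinj]
        exact hcard
    have h1 := (hd n).trans (add_le_add_left (hDle _ hmany) (d : ℕ∞))
    rw [hK] at h1
    norm_cast at h1
    simp only at h1
    omega
  -- Here `r` would be negative, but Kraft alone allows at most `2 ^ (K + c)` programs of length at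
  -- most `K + c`.
  · have h1 : ∑ q ∈ F.image f, (2⁻¹ : ℝ≥0∞) ^ (K + c) ≤ 1 := by
      refine le_trans (Finset.sum_le_sum fun q hq => ?_)
        ((ENNReal.sum_le_tsum (F.image f)).trans hV.prefixFree_dom.kraft)
      obtain ⟨s, hs, rfl⟩ := Finset.mem_image.1 hq
      have hmem : f s ∈ {p | (V p).Dom} := Part.dom_iff_mem.2 ⟨s, (hf s hs).1⟩
      rw [if_pos hmem]
      exact pow_le_pow_right_of_le_one' (by simp) (hf s hs).2
    rw [Finset.sum_const, Finset.card_image_of_injOn hinj, nsmul_eq_mul, ← ENNReal.inv_pow,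
      ← div_eq_mul_inv, ENNReal.div_le_iff (by simp) (by simp), one_mul] at h1
    have h2 : F.card ≤ 2 ^ (K + c) := by exact_mod_cast h1
    have h3 : 2 ^ (K + c) < 2 ^ m := Nat.pow_lt_pow_right (by norm_num) (by omega)
    have h4 : 2 ^ m ≤ 4 ^ m := Nat.pow_le_pow_left (by norm_num) m
    omega

end Coding

/-! ### Finitely many paths, and compactness. -/

section Paths

theorem length_initialSegment (b : ℕ → Bool) (m : ℕ) : (initialSegment b m).length = m := by
  simp [initialSegment]

theorem initialSegment_eq_iff {b b' : ℕ → Bool} {m : ℕ} :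
    initialSegment b m = initialSegment b' m ↔ ∀ i < m, b i = b' i := by
  simp [initialSegment]

theorem take_initialSegment (b : ℕ → Bool) {j m : ℕ} (h : j ≤ m) :
    (initialSegment b m).take j = initialSegment b j := by
  rw [initialSegment, ← List.map_take, List.take_range, min_eq_left h, initialSegment]

theorem getD_initialSegment (b : ℕ → Bool) {j m : ℕ} (h : j < m) :
    (initialSegment b m).getD j false = b j := by
  simp [initialSegment, h]

theorem initialSegment_getD {s : List Bool} {j : ℕ} (h : j ≤ s.length) :
    initialSegment (fun i => s.getD i false) j = s.take j := by
  apply List.ext_getElem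
  · simp [initialSegment, h]
  · intro i h1 h2
    have : i < s.length := by simp at h2; omega
    simp [initialSegment, this]

theorem exists_initialSegment_injOn (G : Finset (ℕ → Bool)) :
    ∃ m, ∀ b ∈ G, ∀ b' ∈ G, initialSegment b m = initialSegment b' m → b = b' := by
  have h : ∀ x : (ℕ → Bool) × (ℕ → Bool), ∃ i, x.1 ≠ x.2 → x.1 i ≠ x.2 i := by
    intro x
    by_cases hx : x.1 = x.2
    · exact ⟨0, fun h => absurd hx h⟩
    · obtain ⟨i, hi⟩ := Function.ne_iff.1 hx
      exact ⟨i, fun _ => hi⟩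
  choose f hf using h
  refine ⟨(G ×ˢ G).sup f + 1, fun b hb b' hb' he => ?_⟩
  by_contra hne
  refine hf (b, b') hne (initialSegment_eq_iff.1 he _ (Nat.lt_succ_of_le ?_))
  exact Finset.le_sup (f := f) (Finset.mem_product.2 ⟨hb, hb'⟩)

theorem isClosed_setOf_initialSegment (p : List Bool → Prop) (j : ℕ) :
    IsClosed {b : ℕ → Bool | p (initialSegment b j)} := by
  have hc : Continuous fun (b : ℕ → Bool) (k : Fin j) => b k :=
    continuous_pi fun k => continuous_apply _
  have he : ∀ b, initialSegment b j = List.ofFn fun k : Fin j => b k := by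
    intro b
    apply List.ext_getElem <;> simp [initialSegment]
  simp only [he]
  exact (isClosed_discrete {x : Fin j → Bool | p (List.ofFn x)}).preimage hc

/-- König's lemma for binary sequences all of whose initial segments satisfy a predicate. -/
theorem exists_forall_initialSegment (p : List Bool → Prop)
    (h : ∀ N, ∃ b : ℕ → Bool, ∀ j ≤ N, p (initialSegment b j)) :
    ∃ b : ℕ → Bool, ∀ j, p (initialSegment b j) := by
  have hcl : ∀ N, IsClosed {b : ℕ → Bool | ∀ j ≤ N, p (initialSegment b j)} := by
    intro N
    simp only [Set.ofPred_forall]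
    exact isClosed_iInter fun j => isClosed_iInter fun _ => isClosed_setOf_initialSegment p j
  obtain ⟨b, hb⟩ := IsCompact.nonempty_iInter_of_sequence_nonempty_isCompact_isClosed
    (fun N => {b : ℕ → Bool | ∀ j ≤ N, p (initialSegment b j)})
    (fun N b hb j hj => hb j (by omega)) h (hcl 0).isCompact hcl
  exact ⟨b, fun j => Set.mem_iInter.1 hb j j le_rfl⟩

variable {U : List Bool →. ℕ} {V : List Bool →. List Bool}

/-- Distinct paths separate at some common level, where the counting bound applies. -/
theorem finite_setOf_complexity_initialSegment_le (hU : IsOptimal U)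
    (hV : IsPrefixDecompressor V) (c : ℕ) :
    {b : ℕ → Bool | ∀ n, complexity V (initialSegment b n) ≤ complexity U n + c}.Finite := by
  classical
  by_contra hinf
  obtain ⟨B, hB⟩ := exists_card_bound hU hV c
  obtain ⟨G, hG, hcard⟩ := Set.Infinite.exists_subset_card_eq hinf B
  obtain ⟨m, hm⟩ := exists_initialSegment_injOn G
  have h := hB m (G.image fun b => initialSegment b m) fun s hs => by
    obtain ⟨b, hb, rfl⟩ := Finset.mem_image.1 hs
    exact ⟨length_initialSegment b m, hG hb m⟩
  rw [Finset.card_image_of_injOn fun b hb b' hb' h => hm b hb b' hb' h, hcard] at h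
  exact lt_irrefl _ h

/-- If no level sufficed, König's lemma would yield a full path through the same prefix but with
another bit at `n`, contradicting isolation. -/
theorem exists_level_of_isolated {p : List Bool → Prop} {a : ℕ → Bool} {m : ℕ}
    (hm : ∀ b : ℕ → Bool, (∀ j, p (initialSegment b j)) →
      initialSegment b m = initialSegment a m → b = a) (n : ℕ) :
    ∃ N, ∀ b : ℕ → Bool, (∀ j ≤ N, p (initialSegment b j)) →
      initialSegment b m = initialSegment a m → b n = a n := by
  by_contra! hc
  obtain ⟨b, hb⟩ := exists_forall_initialSegment
    -- The two length guards make the extra conditions vacuous on segments too short to decide them.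
    (fun s => p s ∧ (m ≤ s.length → s.take m = initialSegment a m) ∧
      (n < s.length → s.getD n false ≠ a n)) fun N => by
    obtain ⟨b, h1, h2, h3⟩ := hc N
    refine ⟨b, fun j hj => ⟨h1 j hj, fun h => ?_, fun h => ?_⟩⟩
    · rw [length_initialSegment] at h
      rw [take_initialSegment b h, h2]
    · rw [length_initialSegment] at h
      rw [getD_initialSegment b h]
      exact h3
  have h1 := (hb m).2.1 (length_initialSegment b m).ge
  have h2 := (hb (n + 1)).2.2 (by rw [length_initialSegment]; exact Nat.lt_succ_self n)
  rw [take_initialSegment b le_rfl] at h1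
  rw [getD_initialSegment b (Nat.lt_succ_self n), hm b (fun j => (hb j).1) h1] at h2
  exact h2 rfl

end Paths

/-! ### The `Σ₂` definition of the bits. -/

section Refutation

variable {U : List Bool →. ℕ} {V : List Bool →. List Bool}

/-- Some finite string `s` extending `t`, whose bit at the place `n` is not `i`, has for every pair
`(p, j)` in the list an initial segment of length `j` of complexity at most `p.length + c`. -/
def Refuted (V : List Bool →. List Bool) (c : ℕ) (t : List Bool)
    (x : ℕ × Bool × List (List Bool × ℕ)) : Prop :=
  ∃ s : List Bool, (∀ y ∈ x.2.2, ∃ q, s.take y.2 ∈ V q ∧ q.length ≤ y.1.length + c ∧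
    y.2 ≤ s.length) ∧ s.getD x.1 false ≠ x.2.1 ∧ s.take t.length = t

theorem rePred_refuted (hV : Partrec V) (c : ℕ) (t : List Bool) : REPred (Refuted V c t) := by
  have h1 : REPred fun x : ((List Bool × ℕ) × List Bool) × List Bool =>
      x.1.2.take x.1.1.2 ∈ V x.2 ∧ x.2.length ≤ x.1.1.1.length + c ∧
        x.1.1.2 ≤ x.1.2.length := by
    have hs : Primrec fun x : ((List Bool × ℕ) × List Bool) × List Bool => x.1.2 :=
      Primrec.snd.comp Primrec.fst
    have hy : Primrec fun x : ((List Bool × ℕ) × List Bool) × List Bool => x.1.1 :=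
      Primrec.fst.comp Primrec.fst
    have hmem : REPred fun x : ((List Bool × ℕ) × List Bool) × List Bool =>
        x.1.2.take x.1.1.2 ∈ V x.2 :=
      (rePred_comp (rePred_mem hV) (Primrec.snd.pair
        (Primrec.list_take.comp (Primrec.snd.comp hy) hs)).to_comp).of_eq fun _ => Iff.rfl
    refine rePred_and hmem (rePred_of_primrecPred ?_)
    exact (Primrec.nat_le.comp (Primrec.list_length.comp Primrec.snd)
      (Primrec.nat_add.comp (Primrec.list_length.comp (Primrec.fst.comp hy))
        (Primrec.const c))).and
      (Primrec.nat_le.comp (Primrec.snd.comp hy) (Primrec.list_length.comp hs))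
  have h2 := rePred_forall_mem_list (p := fun (y : List Bool × ℕ) (s : List Bool) =>
    ∃ q, s.take y.2 ∈ V q ∧ q.length ≤ y.1.length + c ∧ y.2 ≤ s.length) (rePred_exists h1)
  have h3 : REPred fun x : (ℕ × Bool × List (List Bool × ℕ)) × List Bool =>
      ∀ y ∈ x.1.2.2, ∃ q, x.2.take y.2 ∈ V q ∧ q.length ≤ y.1.length + c ∧ y.2 ≤ x.2.length :=
    (rePred_comp h2 (Computable.pair (Computable.snd.comp (Computable.snd.comp Computable.fst))
      Computable.snd)).of_eq fun _ => Iff.rfl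
  have h4 : PrimrecPred fun x : (ℕ × Bool × List (List Bool × ℕ)) × List Bool =>
      x.2.getD x.1.1 false ≠ x.1.2.1 ∧ x.2.take t.length = t :=
    (PrimrecPred.not (Primrec.eq.comp
      ((Primrec.list_getD false).comp Primrec.snd (Primrec.fst.comp Primrec.fst))
      (Primrec.fst.comp (Primrec.snd.comp Primrec.fst)))).and
    (Primrec.eq.comp (Primrec.list_take.comp (Primrec.const t.length) Primrec.snd)
      (Primrec.const t))
  exact rePred_exists (rePred_and h3 (rePred_of_primrecPred h4))

theorem rePred_forall_mem_output (hU : Partrec U) :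
    REPred fun x : ℕ × Bool × List (List Bool × ℕ) => ∀ y ∈ x.2.2, y.2 ∈ U y.1 := by
  have h1 : REPred fun x : (List Bool × ℕ) × Unit => x.1.2 ∈ U x.1.1 :=
    (rePred_comp (rePred_mem hU) (f := fun x : (List Bool × ℕ) × Unit => x.1)
      Computable.fst).of_eq fun _ => Iff.rfl
  have h2 := rePred_forall_mem_list (p := fun (y : List Bool × ℕ) (_ : Unit) => y.2 ∈ U y.1) h1
  exact (rePred_comp h2 (Computable.pair (Computable.snd.comp Computable.snd)
    (Computable.const ()))).of_eq fun _ => Iff.rfl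

theorem computableIn_haltingOracle_of_complexity_le (hU : IsOptimal U)
    (hV : IsPrefixDecompressor V) {a : ℕ → Bool} {c : ℕ}
    (ha : ∀ n, complexity V (initialSegment a n) ≤ complexity U n + c) :
    ComputableIn {haltingOracle} a := by
  classical
  -- The prefix of length `m` separates `a` from the finitely many other paths.
  obtain ⟨m, hm⟩ := exists_initialSegment_injOn
    (finite_setOf_complexity_initialSegment_le hU hV c).toFinset
  let p : List Bool → Prop := fun s => complexity V s ≤ complexity U s.length + c
  have hp : ∀ (b : ℕ → Bool) j, p (initialSegment b j) ↔
      complexity V (initialSegment b j) ≤ complexity U j + c := by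
    intro b j
    simp only [p, length_initialSegment]
  have hiso : ∀ b : ℕ → Bool, (∀ j, p (initialSegment b j)) →
      initialSegment b m = initialSegment a m → b = a := fun b hb h =>
    hm b (by simpa [hp] using hb) a (by simpa using ha) h
  have hprog : ∀ j, ∃ q, j ∈ U q ∧ complexity U j = q.length := by
    intro j
    obtain ⟨k, hk⟩ := hU.exists_complexity_eq j
    obtain ⟨q, hq, hl⟩ := complexity_le_coe_iff.1 hk.le
    exact ⟨q, hq, le_antisymm (iInf₂_le q hq) (by rw [hk]; exact_mod_cast hl)⟩
  refine computableIn_haltingOracle_of_graph (rePred_forall_mem_output hU.partrec)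
    (rePred_refuted hV.partrec c (initialSegment a m)) fun n i => ⟨?_, ?_⟩
  · rintro rfl
    obtain ⟨N, hN⟩ := exists_level_of_isolated hiso n
    choose f hf hfl using hprog
    -- Shortest programs for all `j ≤ N` give the exact bounds `K(j) + c`, so a refuting string
    -- would contradict the choice of `N`.
    refine ⟨(List.range (N + 1)).map fun j => (f j, j), ?_, ?_⟩
    · intro y hy
      obtain ⟨j, -, rfl⟩ := List.mem_map.1 hy
      exact hf j
    · rintro ⟨s, hs, hne, ht⟩
      have hs' : ∀ j ≤ N, ∃ q, s.take j ∈ V q ∧ q.length ≤ (f j).length + c ∧ j ≤ s.length :=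
        fun j hj => hs (f j, j) (List.mem_map.2 ⟨j, List.mem_range.2 (by omega), rfl⟩)
      rw [length_initialSegment] at ht
      have hms : m ≤ s.length := by
        have := congrArg List.length ht
        rw [length_initialSegment, List.length_take] at this
        omega
      -- Padding `s` with `false` agrees with the default bit read in `Refuted`.
      refine hne (hN (fun i => s.getD i false) (fun j hj => ?_) ?_)
      · obtain ⟨q, hq, hl, hj'⟩ := hs' j hj
        rw [hp, initialSegment_getD hj', hfl]
        exact (iInf₂_le q hq).trans (by exact_mod_cast hl)
      · rw [initialSegment_getD hms, ht]
  · rintro ⟨X, hX, hn⟩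
    by_contra hne
    have hle : ∀ y ∈ X, y.2 ≤ n + 1 + m + (X.map Prod.snd).sum := fun y hy =>
      (List.single_le_sum (by simp) _ (List.mem_map_of_mem hy)).trans (Nat.le_add_left _ _)
    -- If `i` were wrong, a prefix of `a` itself would refute it: it obeys every bound from genuine
    -- programs, even ones that are not shortest. Its length covers place `n`, the prefix of length
    -- `m`, and every `j` in the list.
    refine hn ⟨initialSegment a (n + 1 + m + (X.map Prod.snd).sum), fun y hy => ?_, ?_, ?_⟩
    · have h1 : complexity V (initialSegment a y.2) ≤ ((y.1.length + c : ℕ) : ℕ∞) := by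
        refine (ha y.2).trans ?_
        push_cast
        gcongr
        exact iInf₂_le y.1 (hX y hy)
      obtain ⟨q, hq, hl⟩ := complexity_le_coe_iff.1 h1
      refine ⟨q, ?_, hl, ?_⟩
      · rw [take_initialSegment a (hle y hy)]
        exact hq
      · rw [length_initialSegment]
        exact hle y hy
    · rw [getD_initialSegment a (by omega)]
      exact hne
    · rw [length_initialSegment, take_initialSegment a (by omega)]

end Refutation
end KTriv

theorem mainTheorem6 (U : List Bool →. ℕ) (V : List Bool →. List Bool)
    (hU : KTriv.IsOptimal U) (hV : KTriv.IsOptimal V)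
    (a : ℕ → Bool) (ha : KTriv.IsKTrivial U V a) :
    ComputableIn {KTriv.haltingOracle} a := by
  obtain ⟨c, hc⟩ := ha
  exact KTriv.computableIn_haltingOracle_of_complexity_le hU hV.toIsPrefixDecompressor
    fun n => (hc n).1
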